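/- Let $n\in\mathbb N$, $k_A,k_B,k_C>0$, and let $\omega:[0,1]\to[0,1]$ be a modulus of continuity (continuous, increasing, concave, $\omega(0)=0$) satisfying the Osgood condition $\int_0^1\frac{ds}{\omega(s)}=+\infty$. For $T>0$ consider operators $$\mathcal Lu=\partial_tu+\sum_{i,j=1}^n\partial_{x_i}\big(a_{i,j}(t)\partial_{x_j}u\big)+\sum_{j=1}^nb_j(t)\partial_{x_j}u+c(t)u\qquad\text{on }[0,T]\times\mathbb R^n,$$ with $a_{i,j}$ real and $b_j,c$ complex valued, such that for all $t\in[0,T]$, $\xi\in\mathbb R^n$ and all $i,j$: $a_{i,j}(t)=a_{j,i}(t)$; $k_A|\xi|^2\le\sum_{i,j}a_{i,j}(t)\xi_i\xi_j\le k_A^{-1}|\xi|^2$; $|b_j(t)|\le k_B$; $|c(t)|\le k_C$; and $a_{i,j}\in C^\omega([0,T])$, i.e. $|a_{i,j}(t)-a_{i,j}(s)|\le M\,\omega(|t-s|)$ for some $M$ and all $s,t\in[0,T]$ with $0<|t-s|<1$. Call such operators admissible. Let $\mathcal H_0=C([0,T],L^2(\mathbb R^n))\cap C([0,T[,H^1(\mathbb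 R^n))\cap C^1([0,T[,L^2(\mathbb R^n))$ (complex valued functions), and, with $\hat f(\xi)=(2\pi)^{-n/2}\int e^{-ix\cdot\xi}f(x)\,dx$, $$\|f\|_{H^1}^2=\int_{\mathbb R^n}(1+|\xi|^2)|\hat f(\xi)|^2d\xi,\qquad \|f\|^2_{H^0_{\nu,\epsilon}}=\int_{\mathbb R^n}e^{2\nu|\xi|^{1/\epsilon}}|\hat f(\xi)|^2d\xi\in[0,+\infty].$$ The equation $\mathcal Lu=0$ is understood in the sense of distributions in $x$ for almost every $t\in\,]0,T[$. Theorem. There exists $\alpha_1>0$, depending only on $k_A,k_B,k_C,\omega,n$, such that for all $0<T''<T$ there exist constants $0<\rho\le k_A$ and $C>0$, depending only on $k_A,k_B,k_C,\omega,n,T,T''$, and, for all $\nu>0$ and $\epsilon>1$, a strictly decreasing function $g:\,]0,k_A]\to[0,+\infty[$ with $\lim_{y\to0}g(y)=+\infty$, depending only on $k_A,k_B,k_C,\omega,n,T,T'',\nu,\epsilon$, with the following property. Put $\sigma=\min\{T'',1/\alpha_1\}$ and $\bar\sigma=\sigma/8$. If $\mathcal L$ is admissible, $u\in\mathcal H_0$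 solves $\mathcal Lu=0$ and $\|u(0,\cdot)\|^2_{H^0_{\nu,\epsilon}}<\rho$, then $$\sup_{z\in[0,\bar\sigma]}\|u(z,\cdot)\|^2_{H^1}\le C\,e^{-\sigma g\left(\|u(0,\cdot)\|^2_{H^0_{\nu,\epsilon}}\right)}\left[1+\|u(\sigma,\cdot)\|^2_{H^1}\right],$$ where for $u(0,\cdot)=0$ the right-hand side is read as $0$ (i.e. $g(0)=+\infty$, $e^{-\infty}=0$), so that then $u(z,\cdot)=0$ for all $z\in[0,\bar\sigma]$. -/

import Mathlib

open MeasureTheory Set Filter Topology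
open scoped ENNReal FourierTransform LineDeriv SchwartzMap

noncomputable section

namespace BackwardParabolic

/-- The Euclidean space `ℝⁿ`. -/
abbrev Rn (n : ℕ) : Type := EuclideanSpace ℝ (Fin n)

/-- The space `L²(ℝⁿ)` (complex valued, so that real valued functions are included). -/
abbrev L2 (n : ℕ) : Type := Lp ℂ 2 (volume : Measure (Rn n))

/-- A modulus of continuity: a function `ω : [0,1] → [0,1]` which is continuous, (weakly)
increasing, concave and vanishes at `0`. Only the values of `ω` on `[0,1]` matter. -/
structure IsModulusOfContinuity (ω : ℝ → ℝ) : Prop where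
  mapsTo : MapsTo ω (Icc 0 1) (Icc 0 1)
  continuousOn : ContinuousOn ω (Icc 0 1)
  monotoneOn : MonotoneOn ω (Icc 0 1)
  concaveOn : ConcaveOn ℝ (Icc 0 1) ω
  map_zero : ω 0 = 0

/-- The Osgood condition `∫₀¹ ds / ω(s) = +∞`. -/
def Osgood (ω : ℝ → ℝ) : Prop :=
  ∫⁻ s in Ioo (0 : ℝ) 1, (ENNReal.ofReal (ω s))⁻¹ = ∞

/-- `f ∈ C^ω([0,T])`: the quotients `|f(t) - f(s)| / ω(|t - s|)`, `0 < |t - s| < 1`,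
are bounded. -/
def HasRegularity (ω : ℝ → ℝ) (T : ℝ) (f : ℝ → ℝ) : Prop :=
  ∃ M : ℝ, ∀ t ∈ Icc 0 T, ∀ s ∈ Icc 0 T, 0 < |t - s| → |t - s| < 1 →
    |f t - f s| ≤ M * ω |t - s|

/-- The assumptions on the coefficients of
`𝓛 u = ∂ₜ u + ∑ᵢⱼ ∂ᵢ (aᵢⱼ(t) ∂ⱼ u) + ∑ⱼ bⱼ(t) ∂ⱼ u + c(t) u` on `[0,T] × ℝⁿ`. -/
structure IsAdmissible {n : ℕ} (T kA kB kC : ℝ) (ω : ℝ → ℝ)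
    (a : ℝ → Matrix (Fin n) (Fin n) ℝ) (b : ℝ → Fin n → ℂ) (c : ℝ → ℂ) : Prop where
  symm : ∀ t ∈ Icc 0 T, ∀ i j, a t i j = a t j i
  lower : ∀ t ∈ Icc 0 T, ∀ ξ : Rn n, kA * ‖ξ‖ ^ 2 ≤ ∑ i, ∑ j, a t i j * ξ i * ξ j
  upper : ∀ t ∈ Icc 0 T, ∀ ξ : Rn n, ∑ i, ∑ j, a t i j * ξ i * ξ j ≤ kA⁻¹ * ‖ξ‖ ^ 2
  bound_b : ∀ t ∈ Icc 0 T, ∀ i, ‖b t i‖ ≤ kB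
  bound_c : ∀ t ∈ Icc 0 T, ‖c t‖ ≤ kC
  regular : ∀ i j, HasRegularity ω T (fun t => a t i j)

/-- The Fourier transform of `f ∈ L²(ℝⁿ)` in the unitary angular-frequency normalization
`f̂(ξ) = (2π)^(-n/2) ∫ e^(-i x·ξ) f(x) dx`, for which `∂ⱼ` becomes multiplication by `i ξⱼ`.
(Mathlib's `𝓕` has the kernel `e^(-2πi x·ξ)`.) -/
def fourierHat {n : ℕ} (f : L2 n) (ξ : Rn n) : ℂ :=
  (((2 * Real.pi) ^ (-(n : ℝ) / 2) : ℝ) : ℂ) * (𝓕 f : L2 n) ((2 * Real.pi)⁻¹ • ξ)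

/-- The squared Gevrey-Sobolev norm of `H^d_{a,ε}(ℝⁿ)`,
`∫ (1 + |ξ|²)^d e^(2a|ξ|^(1/ε)) |f̂(ξ)|² dξ ∈ [0,∞]`. -/
def gevreyNormSq {n : ℕ} (d a ε : ℝ) (f : L2 n) : ℝ≥0∞ :=
  ∫⁻ ξ : Rn n, ENNReal.ofReal ((1 + ‖ξ‖ ^ 2) ^ d * Real.exp (2 * a * ‖ξ‖ ^ (1 / ε))) *
    ‖fourierHat f ξ‖ₑ ^ 2

/-- The squared norm of `H¹(ℝⁿ)`, `∫ (1 + |ξ|²) |f̂(ξ)|² dξ ∈ [0,∞]`; a function of `L²` belongs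
to `H¹` if and only if this is finite. -/
def sobolevNormSq {n : ℕ} (f : L2 n) : ℝ≥0∞ :=
  ∫⁻ ξ : Rn n, ENNReal.ofReal (1 + ‖ξ‖ ^ 2) * ‖fourierHat f ξ‖ₑ ^ 2

/-- The space `C([0,T], L²) ∩ C([0,T[, H¹) ∩ C¹([0,T[, L²)`. -/
structure MemH0 {n : ℕ} (T : ℝ) (u : ℝ → L2 n) : Prop where
  continuousOn : ContinuousOn u (Icc 0 T)
  mem_sobolev : ∀ t ∈ Ico 0 T, sobolevNormSq (u t) < ∞
  continuousOn_sobolev : ∀ t ∈ Ico 0 T,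
    Tendsto (fun s => sobolevNormSq (u s - u t)) (𝓝[Ico 0 T] t) (𝓝 0)
  contDiffOn : ContDiffOn ℝ 1 u (Ico 0 T)

/-- The spatial derivative `∂ᵢ` of tempered distributions on `ℝⁿ`. -/
def partialD {n : ℕ} (i : Fin n) (f : 𝓢'(Rn n, ℂ)) : 𝓢'(Rn n, ℂ) :=
  ∂_{(EuclideanSpace.single i (1 : ℝ) : Rn n)} f

/-- `𝓛 u = 0` on `]0,T[ × ℝⁿ`: for almost every `t ∈ ]0,T[`,
`∂ₜ u + ∑ᵢⱼ ∂ᵢ (aᵢⱼ(t) ∂ⱼ u) + ∑ⱼ bⱼ(t) ∂ⱼ u + c(t) u = 0` holds in the sense of tempered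
distributions on `ℝⁿ`, where `∂ₜ u` is the derivative of the `L²`-valued function `u`. -/
def IsSolution {n : ℕ} (T : ℝ) (a : ℝ → Matrix (Fin n) (Fin n) ℝ) (b : ℝ → Fin n → ℂ)
    (c : ℝ → ℂ) (u : ℝ → L2 n) : Prop :=
  ∀ᵐ t : ℝ, t ∈ Ioo 0 T →
    (Lp.toTemperedDistribution (deriv u t) : 𝓢'(Rn n, ℂ))
      + ∑ i, ∑ j, partialD i ((a t i j : ℂ) • partialD j (Lp.toTemperedDistribution (u t)))
      + ∑ j, b t j • partialD j (Lp.toTemperedDistribution (u t))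
      + c t • (Lp.toTemperedDistribution (u t) : 𝓢'(Rn n, ℂ)) = 0

end BackwardParabolic

end

noncomputable section

namespace BackwardParabolic

/-! The coefficients depend on `t` alone, so the Fourier transform in `x` turns the equation into an
ODE at each frequency, û' = p(t,ξ) û (`fourier_equation`), where Re p lies between kA|ξ|² and
kA⁻¹|ξ|² up to lower-order terms (`IsAdmissible.symbol_re_bounds`). Gronwall then applies in both
directions. For |ξ|² ≤ s, |û(z)|² is at most e^{O(1+s)} |û(0)|² (`fourierHat_low`). For |ξ|² > s,
growth from z to σ read backwards makes |û(z)|² smaller than |û(σ)|² by a factor of order e^{-kA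
s(σ-z)} (`fourierHat_high`).

Adding the two ranges (`sobolevNormSq_le_split`) and taking s proportional to log(1/y), with y the
squared norm of the datum, gives a Hölder-type bound y^θ (1 + ‖u(σ)‖²). Hence g may be taken
logarithmic: e^{-σ g(y)} = (y/kA)^θ. -/

/-! ### The equation on the Fourier side -/

/-- An `L²` function whose distribution is `g` times the distribution of `f`, with `g` of temperate
growth, is almost everywhere equal to `g * f`. -/
theorem ae_eq_mul_of_toTemperedDistribution_eq {n : ℕ} {g : Rn n → ℂ} (hg : g.HasTemperateGrowth)
    {f f' : L2 n} (h : (Lp.toTemperedDistribution f' : 𝓢'(Rn n, ℂ)) =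
      TemperedDistribution.smulLeftCLM ℂ g (Lp.toTemperedDistribution f)) :
    ∀ᵐ η, f' η = g η * f η := by
  have hf : LocallyIntegrable f volume := (Lp.memLp f).locallyIntegrable (by norm_num)
  have hf' : LocallyIntegrable f' volume := (Lp.memLp f').locallyIntegrable (by norm_num)
  have hgf : LocallyIntegrable (fun η => g η * f η) volume := by
    rw [← locallyIntegrableOn_univ] at hf ⊢
    exact hf.continuousOn_mul hg.1.continuous.continuousOn isOpen_univ.isLocallyClosed
  have key : ∀ᵐ η, f' η - g η * f η = 0 := by
    refine ae_eq_zero_of_integral_contDiff_smul_eq_zero (hf'.sub hgf) fun φ hφ hφc => ?_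
    -- A real bump function, viewed as complex valued, is a Schwartz function, so it may be fed to
    -- the distributional identity.
    have h₁ : HasCompactSupport (Complex.ofRealCLM ∘ φ) := hφc.comp_left rfl
    have h₂ : ContDiff ℝ ((⊤ : ℕ∞) : WithTop ℕ∞) (Complex.ofRealCLM ∘ φ) :=
      Complex.ofRealCLM.contDiff.comp hφ
    have := DFunLike.congr_fun h (h₁.toSchwartzMap h₂)
    simp only [TemperedDistribution.smulLeftCLM_apply_apply, Lp.toTemperedDistribution_apply,
      SchwartzMap.smulLeftCLM_apply_apply hg] at this
    have e1 : Integrable (fun η => φ η • f' η) :=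
      hf'.integrable_smul_left_of_hasCompactSupport hφ.continuous hφc
    have e2 : Integrable (fun η => φ η • (g η * f η)) :=
      hgf.integrable_smul_left_of_hasCompactSupport hφ.continuous hφc
    have : ∫ η, φ η • f' η = ∫ η, φ η • (g η * f η) := by
      refine Eq.trans ?_ (this.trans ?_)
      · congr 1
      · congr 1; ext η; simp [mul_left_comm, mul_assoc]
    calc ∫ η, φ η • (f' η - g η * f η) = ∫ η, (φ η • f' η - φ η • (g η * f η)) := by
          simp only [smul_sub]
      _ = 0 := by rw [integral_sub e1 e2, this, sub_self]
  filter_upwards [key] with η h using sub_eq_zero.1 h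

/-- The symbol of the spatial part of `-𝓛`, in the frequency variable of Mathlib's `𝓕`. -/
def symbol {n : ℕ} (a : Matrix (Fin n) (Fin n) ℝ) (b : Fin n → ℂ) (c : ℂ) (η : Rn n) : ℂ :=
  ((∑ i, ∑ j, a i j * (2 * Real.pi * η i) * (2 * Real.pi * η j) : ℝ) : ℂ)
    - ∑ j, b j * (2 * Real.pi * Complex.I * η j) - c

theorem hasTemperateGrowth_coord {n : ℕ} (i : Fin n) :
    (fun η : Rn n => ((η i : ℝ) : ℂ)).HasTemperateGrowth :=
  (Complex.ofRealCLM ∘L EuclideanSpace.proj i).hasTemperateGrowth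

theorem fourier_partialD {n : ℕ} (i : Fin n) (f : 𝓢'(Rn n, ℂ)) :
    𝓕 (partialD i f) =
      TemperedDistribution.smulLeftCLM ℂ (fun η => 2 * Real.pi * Complex.I * η i) (𝓕 f) := by
  rw [partialD, TemperedDistribution.fourier_lineDerivOp_eq,
    ← smul_apply, ← TemperedDistribution.smulLeftCLM_smul]
  · congr; ext η; simp [EuclideanSpace.inner_single_right]
  · simpa [EuclideanSpace.inner_single_right] using hasTemperateGrowth_coord i

theorem fourier_equation {n : ℕ} {a : Matrix (Fin n) (Fin n) ℝ} {b : Fin n → ℂ} {c : ℂ}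
    {f f' : L2 n} (h : (Lp.toTemperedDistribution f' : 𝓢'(Rn n, ℂ))
      + ∑ i, ∑ j, partialD i ((a i j : ℂ) • partialD j (Lp.toTemperedDistribution f))
      + ∑ j, b j • partialD j (Lp.toTemperedDistribution f)
      + c • (Lp.toTemperedDistribution f : 𝓢'(Rn n, ℂ)) = 0) :
    ∀ᵐ η, (𝓕 f' : L2 n) η = symbol a b c η * (𝓕 f : L2 n) η := by
  have hc : ∀ j : Fin n,
      (fun η : Rn n => 2 * Real.pi * Complex.I * (η j : ℂ)).HasTemperateGrowth := fun j =>
    (Function.HasTemperateGrowth.const _).mul (hasTemperateGrowth_coord j)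
  have hs : ∀ i j : Fin n, (fun η : Rn n => (a i j : ℂ) * ((2 * Real.pi * Complex.I * (η j : ℂ)) *
      (2 * Real.pi * Complex.I * (η i : ℂ)))).HasTemperateGrowth := fun i j =>
    (Function.HasTemperateGrowth.const _).mul ((hc j).mul (hc i))
  have hb : ∀ j : Fin n, (fun η : Rn n => b j *
      (2 * Real.pi * Complex.I * (η j : ℂ))).HasTemperateGrowth := fun j =>
    (Function.HasTemperateGrowth.const _).mul (hc j)
  have hsum := Function.HasTemperateGrowth.sum (s := Finset.univ) fun i _ =>
    Function.HasTemperateGrowth.sum (s := Finset.univ) fun j _ => hs i j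
  have hsumb := Function.HasTemperateGrowth.sum (s := Finset.univ) fun j _ => hb j
  have hcc : (fun _ : Rn n => c).HasTemperateGrowth := Function.HasTemperateGrowth.const _
  have hsym : symbol a b c = -((fun η : Rn n => ∑ i, ∑ j, (a i j : ℂ) *
      ((2 * Real.pi * Complex.I * (η j : ℂ)) * (2 * Real.pi * Complex.I * (η i : ℂ)))) +
      (fun η : Rn n => ∑ j, b j * (2 * Real.pi * Complex.I * (η j : ℂ))) + fun _ => c) := by
    ext η
    have : ∀ i j : Fin n, (a i j : ℂ) * ((2 * Real.pi * Complex.I * (η j : ℂ)) *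
        (2 * Real.pi * Complex.I * (η i : ℂ))) =
        -((a i j : ℂ) * (2 * Real.pi * η i) * (2 * Real.pi * η j)) := fun i j => by
      linear_combination (a i j : ℂ) * 4 * Real.pi ^ 2 * η i * η j * Complex.I_sq
    simp only [symbol, this, Pi.neg_apply, Pi.add_apply, Finset.sum_neg_distrib]
    push_cast
    ring
  refine ae_eq_mul_of_toTemperedDistribution_eq ?_ ?_
  · rw [hsym]; exact ((hsum.add hsumb).add hcc).neg
  have h' := congrArg (FourierTransform.fourierCLM ℂ 𝓢'(Rn n, ℂ)) h
  simp only [map_add, map_sum, map_smul, map_zero, FourierTransform.fourierCLM_apply,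
    fourier_partialD, Lp.fourier_toTemperedDistribution_eq, FourierTransform.fourier_smul] at h'
  rw [hsym, TemperedDistribution.smulLeftCLM_neg ((hsum.add hsumb).add hcc),
    TemperedDistribution.smulLeftCLM_add (hsum.add hsumb) hcc,
    TemperedDistribution.smulLeftCLM_add hsum hsumb,
    TemperedDistribution.smulLeftCLM_sum fun i _ =>
      Function.HasTemperateGrowth.sum (s := Finset.univ) fun j _ => hs i j,
    TemperedDistribution.smulLeftCLM_sum fun j _ => hb j]
  simp only [fun i => TemperedDistribution.smulLeftCLM_sum (F := ℂ) (s := Finset.univ)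
    fun j _ => hs i j]
  have e1 : ∀ i j : Fin n, TemperedDistribution.smulLeftCLM ℂ
      (fun η : Rn n => (a i j : ℂ) * ((2 * Real.pi * Complex.I * (η j : ℂ)) *
      (2 * Real.pi * Complex.I * (η i : ℂ)))) (Lp.toTemperedDistribution (𝓕 f : L2 n)) =
      (a i j : ℂ) • TemperedDistribution.smulLeftCLM ℂ
      (fun η => 2 * Real.pi * Complex.I * η i) (TemperedDistribution.smulLeftCLM ℂ
      (fun η => 2 * Real.pi * Complex.I * η j) (Lp.toTemperedDistribution (𝓕 f : L2 n))) := by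
    intro i j
    rw [TemperedDistribution.smulLeftCLM_smulLeftCLM_apply (hc j) (hc i), ← smul_apply,
      ← TemperedDistribution.smulLeftCLM_smul ((hc j).mul (hc i))]
    rfl
  have e2 : ∀ j : Fin n, TemperedDistribution.smulLeftCLM ℂ
      (fun η : Rn n => b j * (2 * Real.pi * Complex.I * (η j : ℂ)))
      (Lp.toTemperedDistribution (𝓕 f : L2 n)) =
      b j • TemperedDistribution.smulLeftCLM ℂ
      (fun η => 2 * Real.pi * Complex.I * η j) (Lp.toTemperedDistribution (𝓕 f : L2 n)) := by
    intro j
    rw [← smul_apply, ← TemperedDistribution.smulLeftCLM_smul (hc j)]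
    rfl
  simp only [neg_apply, add_apply, sum_apply, e1, e2, TemperedDistribution.smulLeftCLM_const]
  rw [eq_neg_iff_add_eq_zero, ← h']
  abel

/-! ### Gronwall's inequality and the mass on a set of frequencies -/

/-- Gronwall's inequality for a `C¹` function when the differential inequality is only known almost
everywhere. -/
theorem exp_mul_le_of_ae_deriv_ge {F F' : ℝ → ℝ} {T κ : ℝ} (hc : ContinuousOn F (Ico 0 T))
    (hd : ∀ t ∈ Ioo 0 T, HasDerivAt F (F' t) t) (hF' : ContinuousOn F' (Ioo 0 T))
    (hae : ∀ᵐ t : ℝ, t ∈ Ioo 0 T → κ * F t ≤ F' t) {s t : ℝ} (hs : 0 ≤ s) (hst : s ≤ t)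
    (ht : t < T) : Real.exp (κ * (t - s)) * F s ≤ F t := by
  -- The set where the inequality fails is open by continuity and null by hypothesis, hence empty.
  have hall : ∀ t ∈ Ioo 0 T, κ * F t ≤ F' t := by
    have hcont : ContinuousOn (fun t => F' t - κ * F t) (Ioo 0 T) :=
      hF'.sub (continuousOn_const.mul (hc.mono Ioo_subset_Ico_self))
    have hopen := hcont.isOpen_inter_preimage isOpen_Ioo (isOpen_Iio (a := (0 : ℝ)))
    have hnull : volume (Ioo 0 T ∩ (fun t => F' t - κ * F t) ⁻¹' Iio 0) = 0 := by
      refine measure_mono_null ?_ (ae_iff.1 hae)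
      rintro t ⟨ht, ht'⟩ h
      have := h ht
      simp only [mem_preimage, mem_Iio] at ht'
      linarith
    have hempty := hopen.eq_empty_of_measure_zero hnull
    intro t ht
    by_contra! h
    exact (hempty ▸ (⟨ht, by simp only [mem_preimage, mem_Iio]; linarith⟩ :
      t ∈ Ioo 0 T ∩ (fun t => F' t - κ * F t) ⁻¹' Iio 0) : t ∈ (∅ : Set ℝ))
  have hG : ∀ t ∈ Ioo 0 T, HasDerivAt (fun t => Real.exp (-κ * t) * F t)
      (Real.exp (-κ * t) * (F' t - κ * F t)) t := fun t ht => by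
    have h1 : HasDerivAt (fun t : ℝ => Real.exp (-κ * t)) (Real.exp (-κ * t) * (-κ)) t := by
      simpa using ((hasDerivAt_id t).const_mul (-κ)).exp
    exact (h1.mul (hd t ht)).congr_deriv (by ring)
  have hmono : MonotoneOn (fun t => Real.exp (-κ * t) * F t) (Ico 0 T) := by
    refine monotoneOn_of_deriv_nonneg (convex_Ico 0 T)
      ((by fun_prop : Continuous fun t : ℝ => Real.exp (-κ * t)).continuousOn.mul hc) ?_ ?_
    · rw [interior_Ico]
      exact fun t ht => (hG t ht).differentiableAt.differentiableWithinAt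
    · rw [interior_Ico]
      intro t ht
      rw [(hG t ht).deriv]
      exact mul_nonneg (Real.exp_pos _).le (sub_nonneg.2 (hall t ht))
  have h := hmono ⟨hs, hst.trans_lt ht⟩ ⟨hs.trans hst, ht⟩ hst
  have h2 := mul_le_mul_of_nonneg_left h (Real.exp_pos (κ * t)).le
  simp only [← mul_assoc, ← Real.exp_add] at h2
  rwa [show κ * t + -κ * s = κ * (t - s) by ring, show κ * t + -κ * t = 0 by ring, Real.exp_zero,
    one_mul] at h2

/-- The mass of `f` on the set `S`. -/
def massOn {n : ℕ} (S : Set (Rn n)) (f : L2 n) : ℝ :=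
  ‖LpToLpRestrictCLM (Rn n) ℂ ℝ volume 2 S f‖ ^ 2

theorem lintegral_eq_massOn {n : ℕ} (S : Set (Rn n)) (f : L2 n) :
    ∫⁻ η in S, ‖f η‖ₑ ^ 2 = ENNReal.ofReal (massOn S f) := by
  rw [massOn, ENNReal.ofReal_pow (norm_nonneg _), ofReal_norm, Lp.enorm_def,
    eLpNorm_eq_lintegral_rpow_enorm_toReal (by norm_num) (by norm_num)]
  simp only [ENNReal.toReal_ofNat, one_div, ENNReal.rpow_ofNat]
  rw [← ENNReal.rpow_natCast, ← ENNReal.rpow_mul]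
  norm_num
  refine lintegral_congr_ae ?_
  filter_upwards [LpToLpRestrictCLM_coeFn ℝ S f] with η h
  rw [h]

/-- The derivative of `‖f‖²` on `S` along `f'`. -/
def massDerivOn {n : ℕ} (S : Set (Rn n)) (f f' : L2 n) : ℝ :=
  2 * inner ℝ (LpToLpRestrictCLM (Rn n) ℂ ℝ volume 2 S f)
    (LpToLpRestrictCLM (Rn n) ℂ ℝ volume 2 S f')

theorem inner_restrict_eq {n : ℕ} (S : Set (Rn n)) (f f' : L2 n) :
    Integrable (fun η => inner ℝ (f η) (f' η)) (volume.restrict S) ∧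
    inner ℝ (LpToLpRestrictCLM (Rn n) ℂ ℝ volume 2 S f)
      (LpToLpRestrictCLM (Rn n) ℂ ℝ volume 2 S f') = ∫ η in S, inner ℝ (f η) (f' η) := by
  have h : (fun η => inner ℝ (LpToLpRestrictCLM (Rn n) ℂ ℝ volume 2 S f η)
      (LpToLpRestrictCLM (Rn n) ℂ ℝ volume 2 S f' η)) =ᵐ[volume.restrict S]
      fun η => inner ℝ (f η) (f' η) := by
    filter_upwards [LpToLpRestrictCLM_coeFn ℝ S f, LpToLpRestrictCLM_coeFn ℝ S f'] with η h h'
    rw [h, h']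
  exact ⟨(L2.integrable_inner _ _).congr h, by rw [L2.inner_def, integral_congr_ae h]⟩

/-- Pointwise, 2 Re⟨f, m f⟩ = 2 (Re m)|f|²: the imaginary part drops out and bounds on Re m
integrate over `S`. -/
theorem massDerivOn_bounds {n : ℕ} {S : Set (Rn n)} (hS : MeasurableSet S) {f f' : L2 n}
    {m : Rn n → ℂ} (hm : ∀ᵐ η, f' η = m η * f η) (κ : ℝ) :
    ((∀ η ∈ S, κ ≤ 2 * (m η).re) → κ * massOn S f ≤ massDerivOn S f f') ∧
    ((∀ η ∈ S, 2 * (m η).re ≤ κ) → massDerivOn S f f' ≤ κ * massOn S f) := by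
  obtain ⟨i1, e1⟩ := inner_restrict_eq S f f
  obtain ⟨i2, e2⟩ := inner_restrict_eq S f f'
  have hpt : ∀ᵐ η ∂volume.restrict S, 2 * inner ℝ (f η) (f' η) =
      2 * (m η).re * inner ℝ (f η) (f η) := by
    filter_upwards [ae_restrict_of_ae hm] with η h
    simp only [h, Complex.inner, Complex.mul_re, Complex.mul_im, Complex.conj_re, Complex.conj_im]
    ring
  rw [massOn, massDerivOn, ← real_inner_self_eq_norm_sq, e1, e2, ← integral_const_mul,
    ← integral_const_mul]
  constructor <;> intro h
  · refine integral_mono_ae (i1.const_mul _) (i2.const_mul _) ?_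
    filter_upwards [hpt, ae_restrict_mem hS] with η h1 hη
    simp only [h1]
    exact mul_le_mul_of_nonneg_right (h η hη) real_inner_self_nonneg
  · refine integral_mono_ae (i2.const_mul _) (i1.const_mul _) ?_
    filter_upwards [hpt, ae_restrict_mem hS] with η h1 hη
    simp only [h1]
    exact mul_le_mul_of_nonneg_right (h η hη) real_inner_self_nonneg

/-! ### Exponential growth and decay at fixed frequencies -/

section solution

variable {n : ℕ} {T : ℝ} {a : ℝ → Matrix (Fin n) (Fin n) ℝ} {b : ℝ → Fin n → ℂ} {c : ℝ → ℂ}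
  {u : ℝ → L2 n}

/-- The Fourier transform followed by restriction to `S`, as a real continuous linear map. -/
def fourierRestrict (S : Set (Rn n)) : L2 n →L[ℝ] Lp ℂ 2 (volume.restrict S) :=
  LpToLpRestrictCLM (Rn n) ℂ ℝ volume 2 S ∘L
    (FourierTransform.fourierCLM ℂ (L2 n)).restrictScalars ℝ

/-- Time derivatives exist only in the `L²` sense, not frequency by frequency, so Gronwall is run on
the squared norm over `S`, which is `C¹` because restriction and Fourier transform are continuous
linear. -/
theorem MemH0.mass_regularity (hu : MemH0 T u) (S : Set (Rn n)) :
    ContinuousOn (fun t => massOn S (𝓕 (u t))) (Ico 0 T) ∧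
    (∀ t ∈ Ioo 0 T, HasDerivAt (fun t => massOn S (𝓕 (u t)))
      (massDerivOn S (𝓕 (u t)) (𝓕 (deriv u t))) t) ∧
    ContinuousOn (fun t => massDerivOn S (𝓕 (u t)) (𝓕 (deriv u t))) (Ioo 0 T) := by
  have hc : ContinuousOn u (Ico 0 T) := hu.contDiffOn.continuousOn
  have hR := (fourierRestrict S).continuous
  have h1 : ContinuousOn (fun t => fourierRestrict S (u t)) (Ico 0 T) := hR.comp_continuousOn hc
  have hd : ContDiffOn ℝ 1 u (Ioo 0 T) := hu.contDiffOn.mono Ioo_subset_Ico_self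
  have h2 : ContinuousOn (fun t => fourierRestrict S (deriv u t)) (Ioo 0 T) :=
    hR.comp_continuousOn (hd.continuousOn_deriv_of_isOpen isOpen_Ioo le_rfl)
  refine ⟨h1.norm.pow 2, fun t ht => ?_,
    continuousOn_const.mul ((h1.mono Ioo_subset_Ico_self).inner h2)⟩
  have hdt : HasDerivAt u (deriv u t) t :=
    ((hd.differentiableOn one_ne_zero).differentiableAt (isOpen_Ioo.mem_nhds ht)).hasDerivAt
  exact ((fourierRestrict S).hasFDerivAt.comp_hasDerivAt t hdt).norm_sq

theorem IsSolution.fourier (hsol : IsSolution T a b c u) : ∀ᵐ t : ℝ, t ∈ Ioo 0 T →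
    ∀ᵐ η, (𝓕 (deriv u t) : L2 n) η = symbol (a t) (b t) (c t) η * (𝓕 (u t) : L2 n) η := by
  filter_upwards [hsol] with t h ht using fourier_equation (h ht)

theorem measurable_enorm_sq (f : L2 n) : Measurable fun η => ‖f η‖ₑ ^ 2 :=
  (Lp.stronglyMeasurable f).measurable.enorm.pow_const 2

/-- Where the real part of the symbol is bounded below, the Fourier transform of a solution grows at
least exponentially. -/
theorem ae_exp_mul_le (hu : MemH0 T u) (hsol : IsSolution T a b c u) {S : Set (Rn n)}
    (hS : MeasurableSet S) {κ : ℝ}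
    (hκ : ∀ t ∈ Ioo 0 T, ∀ η ∈ S, κ ≤ 2 * (symbol (a t) (b t) (c t) η).re)
    {s t : ℝ} (hs : 0 ≤ s) (hst : s ≤ t) (ht : t < T) : ∀ᵐ η, η ∈ S →
      ENNReal.ofReal (Real.exp (κ * (t - s))) * ‖(𝓕 (u s) : L2 n) η‖ₑ ^ 2 ≤
        ‖(𝓕 (u t) : L2 n) η‖ₑ ^ 2 := by
  rw [← ae_restrict_iff' hS]
  -- Integral inequalities over all measurable pieces of `S` recover the bound almost everywhere.
  refine ae_le_of_forall_setLIntegral_le_of_sigmaFinite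
    ((measurable_enorm_sq _).const_mul _) fun S' hS' _ => ?_
  rw [Measure.restrict_restrict hS', lintegral_const_mul _ (measurable_enorm_sq _),
    lintegral_eq_massOn, lintegral_eq_massOn, ← ENNReal.ofReal_mul (Real.exp_pos _).le]
  obtain ⟨h1, h2, h3⟩ := hu.mass_regularity (S' ∩ S)
  refine ENNReal.ofReal_le_ofReal (exp_mul_le_of_ae_deriv_ge h1 h2 h3 ?_ hs hst ht)
  filter_upwards [hsol.fourier] with t h ht
  exact (massDerivOn_bounds (hS'.inter hS) (h ht) κ).1 fun η hη => hκ t ht η hη.2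

/-- Where the real part of the symbol is bounded above, the Fourier transform of a solution grows at
most exponentially. -/
theorem ae_le_exp_mul (hu : MemH0 T u) (hsol : IsSolution T a b c u) {S : Set (Rn n)}
    (hS : MeasurableSet S) {κ : ℝ}
    (hκ : ∀ t ∈ Ioo 0 T, ∀ η ∈ S, 2 * (symbol (a t) (b t) (c t) η).re ≤ κ)
    {s t : ℝ} (hs : 0 ≤ s) (hst : s ≤ t) (ht : t < T) : ∀ᵐ η, η ∈ S →
      ‖(𝓕 (u t) : L2 n) η‖ₑ ^ 2 ≤
        ENNReal.ofReal (Real.exp (κ * (t - s))) * ‖(𝓕 (u s) : L2 n) η‖ₑ ^ 2 := by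
  rw [← ae_restrict_iff' hS]
  refine ae_le_of_forall_setLIntegral_le_of_sigmaFinite
    (measurable_enorm_sq _) fun S' hS' _ => ?_
  rw [Measure.restrict_restrict hS', lintegral_const_mul _ (measurable_enorm_sq _),
    lintegral_eq_massOn, lintegral_eq_massOn, ← ENNReal.ofReal_mul (Real.exp_pos _).le]
  obtain ⟨h1, h2, h3⟩ := hu.mass_regularity (S' ∩ S)
  -- The upper bound is the lower Gronwall bound for minus the mass.
  refine ENNReal.ofReal_le_ofReal (neg_le_neg_iff.1 ?_)
  rw [← mul_neg]
  refine exp_mul_le_of_ae_deriv_ge (F := fun t => -massOn (S' ∩ S) (𝓕 (u t))) h1.neg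
    (fun t ht => (h2 t ht).neg) h3.neg ?_ hs hst ht
  filter_upwards [hsol.fourier] with t h ht
  rw [mul_neg, neg_le_neg_iff]
  exact (massDerivOn_bounds (hS'.inter hS) (h ht) κ).2 fun η hη => hκ t ht η hη.2

end solution

/-! ### Change to angular frequency -/

theorem measurable_fourierHat {n : ℕ} (f : L2 n) : Measurable (fourierHat f) :=
  ((Lp.stronglyMeasurable (𝓕 f : L2 n)).measurable.comp
    (measurable_const_smul ((2 * Real.pi)⁻¹ : ℝ))).const_mul _

theorem ae_rescale {n : ℕ} {p : Rn n → Prop} (h : ∀ᵐ η, p η) {r : ℝ} (hr : r ≠ 0) :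
    ∀ᵐ ξ : Rn n, p (r • ξ) :=
  (Measure.quasiMeasurePreserving_smul volume hr).ae h

theorem enorm_fourierHat_sq {n : ℕ} (f : L2 n) (ξ : Rn n) : ‖fourierHat f ξ‖ₑ ^ 2 =
    ‖(((2 * Real.pi) ^ (-(n : ℝ) / 2) : ℝ) : ℂ)‖ₑ ^ 2 *
      ‖(𝓕 f : L2 n) ((2 * Real.pi)⁻¹ • ξ)‖ₑ ^ 2 := by
  rw [fourierHat, enorm_mul, mul_pow]

theorem eq_zero_of_fourierHat_ae_eq_zero {n : ℕ} {f : L2 n} (h : ∀ᵐ ξ, fourierHat f ξ = 0) :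
    f = 0 := by
  have hpi : (0 : ℝ) < 2 * Real.pi := by positivity
  have h0 : (𝓕 f : L2 n) = 0 := by
    rw [Lp.eq_zero_iff_ae_eq_zero]
    filter_upwards [ae_rescale h hpi.ne'] with η hη
    rw [fourierHat, smul_smul, inv_mul_cancel₀ hpi.ne', one_smul] at hη
    exact (mul_eq_zero.1 hη).resolve_left
      (Complex.ofReal_ne_zero.2 (Real.rpow_pos_of_pos hpi _).ne')
  rw [← norm_eq_zero, ← Lp.norm_fourier_eq, h0, norm_zero]

/-! ### Low and high frequency estimates and their sum -/

section estimates

variable {n : ℕ} {T kA kB kC : ℝ} {ω : ℝ → ℝ} {a : ℝ → Matrix (Fin n) (Fin n) ℝ}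
  {b : ℝ → Fin n → ℂ} {c : ℝ → ℂ} {u : ℝ → L2 n}

theorem IsAdmissible.symbol_re_bounds (h : IsAdmissible T kA kB kC ω a b c) {t : ℝ}
    (ht : t ∈ Icc 0 T) (η : Rn n) :
    kA * ‖(2 * Real.pi) • η‖ ^ 2 - n * kB * ‖(2 * Real.pi) • η‖ - kC ≤
      (symbol (a t) (b t) (c t) η).re ∧
    (symbol (a t) (b t) (c t) η).re ≤
      kA⁻¹ * ‖(2 * Real.pi) • η‖ ^ 2 + n * kB * ‖(2 * Real.pi) • η‖ + kC := by
  set ξ : Rn n := (2 * Real.pi) • η with hξ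
  have hre : (symbol (a t) (b t) (c t) η).re = (∑ i, ∑ j, a t i j * ξ i * ξ j) -
      (∑ j, b t j * (Complex.I * ξ j) + c t).re := by
    have : ∀ j, b t j * (2 * Real.pi * Complex.I * η j) = b t j * (Complex.I * ξ j) := fun j => by
      simp only [hξ, PiLp.smul_apply, smul_eq_mul]; push_cast; ring
    simp only [symbol, this, Complex.sub_re, Complex.ofReal_re, Complex.add_re]
    simp [hξ]; ring
  have hlow : ‖∑ j, b t j * (Complex.I * ξ j) + c t‖ ≤ n * kB * ‖ξ‖ + kC := by
    refine (norm_add_le _ _).trans (add_le_add ?_ (h.bound_c t ht))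
    refine (norm_sum_le _ _).trans ?_
    calc ∑ j, ‖b t j * (Complex.I * ξ j)‖ ≤ ∑ _j : Fin n, kB * ‖ξ‖ := by
          refine Finset.sum_le_sum fun j _ => ?_
          rw [norm_mul, norm_mul, Complex.norm_I, one_mul, Complex.norm_real]
          exact mul_le_mul (h.bound_b t ht j) (PiLp.norm_apply_le ξ j) (norm_nonneg _)
            ((norm_nonneg _).trans (h.bound_b t ht j))
      _ = n * kB * ‖ξ‖ := by simp [mul_assoc]
  have habs := abs_le.1 ((Complex.abs_re_le_norm _).trans hlow)
  rw [hre]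
  have h1 := h.lower t ht ξ
  have h2 := h.upper t ht ξ
  constructor <;> linarith [habs.1, habs.2]

/-- Growth bound for the low frequencies. -/
theorem fourierHat_low (hkA : 0 < kA) (hkB : 0 < kB) (hkC : 0 < kC)
    (h : IsAdmissible T kA kB kC ω a b c) (hu : MemH0 T u)
    (hsol : IsSolution T a b c u) (s : ℝ) {z : ℝ} (hz : 0 ≤ z) (hzT : z < T) :
    ∀ᵐ ξ, ‖ξ‖ ^ 2 ≤ s → ‖fourierHat (u z) ξ‖ₑ ^ 2 ≤
      ENNReal.ofReal (Real.exp (2 * (kA⁻¹ + n * kB + kC) * (1 + s) * z)) *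
        ‖fourierHat (u 0) ξ‖ₑ ^ 2 := by
  have hpi : (0 : ℝ) < 2 * Real.pi := by positivity
  have hS : MeasurableSet {η : Rn n | ‖(2 * Real.pi) • η‖ ^ 2 ≤ s} :=
    measurableSet_le (by fun_prop) measurable_const
  have key := ae_le_exp_mul hu hsol hS (κ := 2 * (kA⁻¹ + n * kB + kC) * (1 + s))
    (fun t ht η hη => by
      have hb := (h.symbol_re_bounds (Ioo_subset_Icc_self ht) η).2
      simp only [mem_ofPred_eq] at hη
      set r := ‖(2 * Real.pi) • η‖
      have h1 : r ≤ 1 + s := by nlinarith [sq_nonneg (r - 1)]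
      have h2 : kA⁻¹ * r ^ 2 ≤ kA⁻¹ * (1 + s) := by gcongr; linarith
      have h3 : n * kB * r ≤ n * kB * (1 + s) := by gcongr
      have h4 : kC ≤ kC * (1 + s) := by nlinarith [sq_nonneg r]
      linarith) le_rfl hz hzT
  filter_upwards [ae_rescale key (inv_ne_zero hpi.ne')] with ξ hξ hs
  have := hξ (by rwa [smul_smul, mul_inv_cancel₀ hpi.ne', one_smul])
  rw [enorm_fourierHat_sq, enorm_fourierHat_sq, mul_left_comm]
  rw [sub_zero] at this
  gcongr

/-- Growth bound for the high frequencies. -/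
theorem fourierHat_high (hkA : 0 < kA)
    (h : IsAdmissible T kA kB kC ω a b c) (hu : MemH0 T u)
    (hsol : IsSolution T a b c u) (s : ℝ) {z σ : ℝ} (hz : 0 ≤ z) (hzσ : z ≤ σ) (hσT : σ < T) :
    ∀ᵐ ξ, s < ‖ξ‖ ^ 2 → ‖fourierHat (u z) ξ‖ₑ ^ 2 ≤
      ENNReal.ofReal (Real.exp ((2 * (kC + (n * kB) ^ 2 / (2 * kA)) - kA * s) * (σ - z))) *
        ‖fourierHat (u σ) ξ‖ₑ ^ 2 := by
  have hpi : (0 : ℝ) < 2 * Real.pi := by positivity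
  have hS : MeasurableSet {η : Rn n | s < ‖(2 * Real.pi) • η‖ ^ 2} :=
    measurableSet_lt measurable_const (by fun_prop)
  have key := ae_exp_mul_le hu hsol hS (κ := kA * s - 2 * (kC + (n * kB) ^ 2 / (2 * kA)))
    (fun t ht η hη => by
      have hb := (h.symbol_re_bounds (Ioo_subset_Icc_self ht) η).1
      simp only [mem_ofPred_eq] at hη
      set r := ‖(2 * Real.pi) • η‖
      -- Young's inequality: half of the elliptic term absorbs the first-order term.
      have h1 : n * kB * r ≤ kA * r ^ 2 / 2 + (n * kB) ^ 2 / (2 * kA) := by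
        have e : kA * r ^ 2 / 2 + (n * kB) ^ 2 / (2 * kA) - n * kB * r =
            (kA * r - n * kB) ^ 2 / (2 * kA) := by field_simp; ring
        have : 0 ≤ (kA * r - n * kB) ^ 2 / (2 * kA) := by positivity
        linarith
      have h2 : kA * s ≤ kA * r ^ 2 := by gcongr
      linarith) hz hzσ hσT
  filter_upwards [ae_rescale key (inv_ne_zero hpi.ne')] with ξ hξ hs
  have := hξ (by rwa [smul_smul, mul_inv_cancel₀ hpi.ne', one_smul])
  rw [enorm_fourierHat_sq, enorm_fourierHat_sq, mul_left_comm]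
  refine mul_le_mul_right ?_ _
  calc ‖(𝓕 (u z) : L2 n) ((2 * Real.pi)⁻¹ • ξ)‖ₑ ^ 2
      = ENNReal.ofReal (Real.exp ((2 * (kC + (n * kB) ^ 2 / (2 * kA)) - kA * s) * (σ - z))) *
        (ENNReal.ofReal (Real.exp ((kA * s - 2 * (kC + (n * kB) ^ 2 / (2 * kA))) * (σ - z))) *
          ‖(𝓕 (u z) : L2 n) ((2 * Real.pi)⁻¹ • ξ)‖ₑ ^ 2) := by
        rw [← mul_assoc, ← ENNReal.ofReal_mul (Real.exp_pos _).le, ← Real.exp_add, ← add_mul]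
        simp
    _ ≤ _ := by gcongr

/-- Splitting at frequency `|ξ|² = s`. -/
theorem sobolevNormSq_le_split (hkA : 0 < kA) (hkB : 0 < kB) (hkC : 0 < kC)
    (h : IsAdmissible T kA kB kC ω a b c) (hu : MemH0 T u) (hsol : IsSolution T a b c u)
    {s ν ε z σ : ℝ} (hs : 0 ≤ s) (hν : 0 < ν) (hz : 0 ≤ z) (hzσ : z ≤ σ / 8) (hσT : σ < T) :
    sobolevNormSq (u z) ≤
      ENNReal.ofReal (Real.exp ((2 * (kA⁻¹ + n * kB + kC) * σ + 1) * (1 + s))) *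
        gevreyNormSq 0 ν ε (u 0) +
      ENNReal.ofReal (Real.exp (2 * (kC + (n * kB) ^ 2 / (2 * kA)) * σ - kA * s * σ / 2)) *
        sobolevNormSq (u σ) := by
  have hσ : 0 ≤ σ := by linarith
  rw [sobolevNormSq, gevreyNormSq, sobolevNormSq]
  have hm : ∀ t, Measurable fun ξ => ‖fourierHat (u t) ξ‖ₑ ^ 2 := fun t =>
    (measurable_fourierHat (u t)).enorm.pow_const 2
  have hm1 : Measurable fun ξ : Rn n =>
      ENNReal.ofReal ((1 + ‖ξ‖ ^ 2) ^ (0 : ℝ) * Real.exp (2 * ν * ‖ξ‖ ^ (1 / ε))) *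
        ‖fourierHat (u 0) ξ‖ₑ ^ 2 := by
    refine Measurable.mul (Measurable.ennreal_ofReal ?_) (hm 0)
    simp only [Real.rpow_zero, one_mul]
    fun_prop
  have hm2 : Measurable fun ξ : Rn n =>
      ENNReal.ofReal (1 + ‖ξ‖ ^ 2) * ‖fourierHat (u σ) ξ‖ₑ ^ 2 :=
    Measurable.mul (Measurable.ennreal_ofReal (by fun_prop)) (hm σ)
  rw [← lintegral_const_mul _ hm1, ← lintegral_const_mul _ hm2,
    ← lintegral_add_left (hm1.const_mul _)]
  refine lintegral_mono_ae ?_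
  filter_upwards [fourierHat_low hkA hkB hkC h hu hsol s hz (by linarith),
    fourierHat_high hkA h hu hsol s hz (by linarith) hσT] with ξ hlow hhigh
  rcases le_or_gt (‖ξ‖ ^ 2) s with hξ | hξ
  · refine le_add_right ?_
    calc ENNReal.ofReal (1 + ‖ξ‖ ^ 2) * ‖fourierHat (u z) ξ‖ₑ ^ 2
        ≤ ENNReal.ofReal (Real.exp (1 + s)) *
          (ENNReal.ofReal (Real.exp (2 * (kA⁻¹ + n * kB + kC) * (1 + s) * σ)) *
            (1 * ‖fourierHat (u 0) ξ‖ₑ ^ 2)) := by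
          rw [one_mul]
          refine mul_le_mul' (ENNReal.ofReal_le_ofReal ?_) ((hlow hξ).trans ?_)
          -- The `H¹` weight costs e^{1+s}, the source of the `+ 1` in the exponent.
          · linarith [Real.add_one_le_exp (1 + s)]
          · gcongr
            linarith
      _ ≤ ENNReal.ofReal (Real.exp (1 + s)) *
          (ENNReal.ofReal (Real.exp (2 * (kA⁻¹ + n * kB + kC) * (1 + s) * σ)) *
            (ENNReal.ofReal ((1 + ‖ξ‖ ^ 2) ^ (0 : ℝ) * Real.exp (2 * ν * ‖ξ‖ ^ (1 / ε))) *
              ‖fourierHat (u 0) ξ‖ₑ ^ 2)) := by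
          gcongr
          -- Of the Gevrey weight, only the bound below by 1 is needed.
          rw [Real.rpow_zero, one_mul, ← ENNReal.ofReal_one]
          exact ENNReal.ofReal_le_ofReal (Real.one_le_exp (by positivity))
      _ = _ := by
          rw [← mul_assoc, ← ENNReal.ofReal_mul (Real.exp_pos _).le, ← Real.exp_add]
          congr 3
          ring
  · refine le_add_left ?_
    rw [mul_left_comm]
    refine mul_le_mul_right ((hhigh hξ).trans ?_) _
    gcongr
    -- Since z ≤ σ/8, at least half of the time interval remains for the gain.
    have h1 : kA * s * (σ / 2) ≤ kA * s * (σ - z) := by gcongr; linarith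
    have h2 : 2 * (kC + (n * kB) ^ 2 / (2 * kA)) * (σ - z) ≤
        2 * (kC + (n * kB) ^ 2 / (2 * kA)) * σ := by gcongr; linarith
    linarith

theorem fourierHat_ae_eq_zero_of_gevreyNormSq {d ν ε : ℝ} {f : L2 n}
    (h : gevreyNormSq d ν ε f = 0) : ∀ᵐ ξ, fourierHat f ξ = 0 := by
  have hm : Measurable fun ξ : Rn n =>
      ENNReal.ofReal ((1 + ‖ξ‖ ^ 2) ^ d * Real.exp (2 * ν * ‖ξ‖ ^ (1 / ε))) *
        ‖fourierHat f ξ‖ₑ ^ 2 :=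
    Measurable.mul (Measurable.ennreal_ofReal (by fun_prop))
      ((measurable_fourierHat f).enorm.pow_const 2)
  filter_upwards [(lintegral_eq_zero_iff hm).1 h] with ξ hξ
  have : ENNReal.ofReal ((1 + ‖ξ‖ ^ 2) ^ d * Real.exp (2 * ν * ‖ξ‖ ^ (1 / ε))) ≠ 0 := by
    rw [Ne, ENNReal.ofReal_eq_zero, not_le]
    positivity
  exact enorm_eq_zero.1 (pow_eq_zero_iff two_ne_zero |>.1 ((mul_eq_zero.1 hξ).resolve_left this))

/-- The low-frequency bound keeps û zero on each ball |ξ|² ≤ N, and countably many balls exhaust the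
frequencies. -/
theorem eq_zero_of_initial_eq_zero (hkA : 0 < kA) (hkB : 0 < kB) (hkC : 0 < kC)
    (h : IsAdmissible T kA kB kC ω a b c) (hu : MemH0 T u) (hsol : IsSolution T a b c u)
    (h0 : ∀ᵐ ξ, fourierHat (u 0) ξ = 0) {z : ℝ} (hz : 0 ≤ z) (hzT : z < T) : u z = 0 := by
  refine eq_zero_of_fourierHat_ae_eq_zero ?_
  filter_upwards [h0, ae_all_iff.2 fun N : ℕ =>
    fourierHat_low hkA hkB hkC h hu hsol N hz hzT] with ξ h0 hlow
  obtain ⟨N, hN⟩ := exists_nat_ge (‖ξ‖ ^ 2)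
  simpa [h0] using hlow N hN

end estimates

end BackwardParabolic

end

/-! ### Choice of the constants -/

theorem mainTheorem2 (n : ℕ) (kA kB kC : ℝ) (hkA : 0 < kA) (hkB : 0 < kB) (hkC : 0 < kC)
    (ω : ℝ → ℝ) (hω : BackwardParabolic.IsModulusOfContinuity ω)
    (hωO : BackwardParabolic.Osgood ω) :
    ∃ α₁ : ℝ, 0 < α₁ ∧
      ∀ T T'' : ℝ, 0 < T'' → T'' < T →
        ∃ ρ C : ℝ, 0 < ρ ∧ ρ ≤ kA ∧ 0 < C ∧
          ∀ ν ε : ℝ, 0 < ν → 1 < ε →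
            ∃ g : ℝ → ℝ,
              (∀ y ∈ Ioc 0 kA, 0 ≤ g y) ∧
              StrictAntiOn g (Ioc 0 kA) ∧
              Tendsto g (𝓝[>] 0) atTop ∧
              ∀ (a : ℝ → Matrix (Fin n) (Fin n) ℝ) (b : ℝ → Fin n → ℂ) (c : ℝ → ℂ)
                (u : ℝ → BackwardParabolic.L2 n) (σ : ℝ) (y : ℝ≥0∞),
                BackwardParabolic.IsAdmissible T kA kB kC ω a b c →
                BackwardParabolic.MemH0 T u →
                BackwardParabolic.IsSolution T a b c u →
                σ = min T'' (1 / α₁) →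
                y = BackwardParabolic.gevreyNormSq 0 ν ε (u 0) →
                y < ENNReal.ofReal ρ →
                (y ≠ 0 →
                  (⨆ z ∈ Icc 0 (σ / 8), BackwardParabolic.sobolevNormSq (u z)) ≤
                    ENNReal.ofReal (C * Real.exp (-σ * g y.toReal)) *
                      (1 + BackwardParabolic.sobolevNormSq (u σ))) ∧
                (y = 0 → ∀ z ∈ Icc 0 (σ / 8), u z = 0) := by
  -- Any positive `α₁` would do: it enters only through 0 < σ < T.
  refine ⟨1, one_pos, fun T T'' hT'' hT => ?_⟩
  obtain ⟨σ, hσdef⟩ : ∃ σ : ℝ, σ = min T'' (1 / 1) := ⟨_, rfl⟩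
  have hσ : 0 < σ := hσdef ▸ lt_min hT'' (by norm_num)
  have hσT : σ < T := hσdef ▸ (min_le_left _ _).trans_lt hT
  set D : ℝ := kC + (n * kB) ^ 2 / (2 * kA) with hD
  set B : ℝ := 2 * (kA⁻¹ + n * kB + kC) * σ + 1 with hB
  have hDpos : 0 < D := by positivity
  have hBpos : 0 < B := by positivity
  -- The two entries are the powers of y that the low and the high frequencies yield.
  obtain ⟨θ, hθdef⟩ : ∃ θ : ℝ, θ = min (1 / 2) (kA * σ / (4 * B)) := ⟨_, rfl⟩
  have hθ : 0 < θ := hθdef ▸ lt_min (by norm_num) (by positivity)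
  have hθ1 : θ ≤ 1 / 2 := hθdef ▸ min_le_left _ _
  have hθ2 : θ ≤ kA * σ / (4 * B) := hθdef ▸ min_le_right _ _
  -- The bound e^{-2B} on y makes the cutoff s nonnegative. The term θ log kA in `C` undoes the
  -- normalisation g(kA) = 0, which keeps g ≥ 0 up to kA.
  refine ⟨min kA (Real.exp (-(2 * B))), Real.exp (2 * D * σ + kA * σ / 2 + θ * Real.log kA),
    lt_min hkA (Real.exp_pos _), min_le_left _ _, Real.exp_pos _, fun ν ε hν _ =>
    ⟨fun y => θ / σ * (Real.log kA - Real.log y), fun y hy => ?_, fun x hx y hy hxy => ?_, ?_, ?_⟩⟩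
  · exact mul_nonneg (by positivity) (sub_nonneg.2 (Real.log_le_log hy.1 hy.2))
  · exact mul_lt_mul_of_pos_left (sub_lt_sub_left (Real.log_lt_log hx.1 hxy) _) (by positivity)
  · refine Tendsto.const_mul_atTop (by positivity) ?_
    simp only [sub_eq_add_neg]
    exact tendsto_atTop_add_const_left _ _
      (tendsto_neg_atBot_atTop.comp Real.tendsto_log_nhdsGT_zero)
  rintro a b c u τ y h hu hsol hτ hy hyρ
  obtain rfl : σ = τ := hσdef.trans hτ.symm
  refine ⟨fun hy0 => iSup₂_le fun z hz => ?_, fun hy0 z hz => ?_⟩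
  · have hyt : y ≠ ∞ := (hyρ.trans ENNReal.ofReal_lt_top).ne
    have hr : 0 < y.toReal := ENNReal.toReal_pos hy0 hyt
    have hyr : y = ENNReal.ofReal y.toReal := (ENNReal.ofReal_toReal hyt).symm
    have hrρ : y.toReal < Real.exp (-(2 * B)) :=
      ((ENNReal.lt_ofReal_iff_toReal_lt hyt).1 hyρ).trans_le (min_le_right _ _)
    set L := Real.log y.toReal with hL
    have hexpL : Real.exp L = y.toReal := Real.exp_log hr
    have hLB : L < -(2 * B) := (Real.log_lt_iff_lt_exp hr).2 hrρ
    have hs : 0 ≤ -L / (2 * B) - 1 := by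
      rw [sub_nonneg, le_div_iff₀ (by positivity)]; linarith
    -- This s solves B(1 + s) = -L/2: the low-frequency factor is y^{-1/2}, leaving y^{1/2} after
    -- multiplication by y.
    refine (BackwardParabolic.sobolevNormSq_le_split (s := -L / (2 * B) - 1) (ν := ν) (ε := ε)
      hkA hkB hkC h hu hsol hs hν hz.1 hz.2 hσT).trans ?_
    have hfin : Real.exp (2 * D * σ + kA * σ / 2 + θ * Real.log kA) *
        Real.exp (-σ * (θ / σ * (Real.log kA - L))) =
        Real.exp (2 * D * σ + kA * σ / 2 + θ * L) := by
      rw [← Real.exp_add]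
      congr 1
      field_simp
      ring
    have hcancel : B * (1 + (-L / (2 * B) - 1)) = -L / 2 := by field_simp; ring
    have hsplit : kA * (-L / (2 * B) - 1) * σ / 2 =
        -(kA * σ / (4 * B) * L) - kA * σ / 2 := by field_simp; ring
    have hDσ : 0 < D * σ := by positivity
    have hAσ : 0 < kA * σ := by positivity
    rw [← hy, ← hD, ← hB, hfin, hcancel, hsplit, mul_add (ENNReal.ofReal _), mul_one, hyr, ← hexpL,
      ← ENNReal.ofReal_mul (Real.exp_pos _).le, ← Real.exp_add]
    refine add_le_add (ENNReal.ofReal_le_ofReal (Real.exp_le_exp.2 ?_))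
      (mul_le_mul_left (ENNReal.ofReal_le_ofReal (Real.exp_le_exp.2 ?_)) _)
    -- As L < 0, lowering the exponent to θ enlarges the bound.
    · have h1 : 1 / 2 * L ≤ θ * L := mul_le_mul_of_nonpos_right hθ1 (by linarith)
      linarith
    · have h1 : kA * σ / (4 * B) * L ≤ θ * L := mul_le_mul_of_nonpos_right hθ2 (by linarith)
      linarith
  · rw [hy0] at hy
    exact BackwardParabolic.eq_zero_of_initial_eq_zero hkA hkB hkC h hu hsol
      (BackwardParabolic.fourierHat_ae_eq_zero_of_gevreyNormSq hy.symm) hz.1 (by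
        linarith [hz.2])
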